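/- Four bugs, numbered cyclically $1,2,3,4$ (with bug $5$ being bug $1$), are on the unit circle. At time $t\ge 0$ bug $j$ is at the point $e^{i\theta_j(t)}$. Bug $j$ chases bug $j+1$ along the shorter arc with unit angular speed: $$\frac{d\theta_j}{dt}=\begin{cases}+1,&(\theta_{j+1}-\theta_j)\bmod 2\pi\in(0,\pi),\\-1,&(\theta_{j+1}-\theta_j)\bmod 2\pi\in(\pi,2\pi),\\0,&(\theta_{j+1}-\theta_j)\bmod 2\pi=\pi.\end{cases}$$ When bugs $j$ and $j+1$ meet, they form a cluster and collectively chase the next bug. That is, consecutive bugs at the same point all have the velocity given by the above rule with the first following bug that is not at that point in place of bug $j+1$. Non-consecutive bugs pass through one another. If all four bugs are at one point, they are at rest. Solutions are understood in the integrated (Carathéodory) sense: $\theta_j(t)=\theta_j(0)+\int_0^t v_j(\theta(s))\,ds$, where $v_j$ is the velocity just described. Suppose that the initial angles $\theta_1(0),\dots,\theta_4(0)$ are independent and uniformly distributed on $[0,2\pi)$. Then almost surely there is exactly one solution on $[0,\infty)$. With probability $p_4=\frac13$ the bugs end in a cycle state, i.e. there are a time $T\ge0$ and a direction such that all four bugs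 move in this direction at unit angular speed at all times $t\ge T$. Almost surely, if they do not end in a cycle state, they coalesce, i.e. there are a time $T\ge 0$ and a point of the circle at which all four bugs are for all $t\ge T$. Almost surely exactly one of the two happens, so the bugs coalesce with probability $1-p_4=\frac23$. -/

import Mathlib

open MeasureTheory ProbabilityTheory Set
open scoped Real

noncomputable section

/-- The representative of the real number `x` modulo `2π` in `[0, 2π)`. -/
def angleMod (x : ℝ) : ℝ := toIcoMod Real.two_pi_pos 0 x

open Classical in
/-- The direction in which a bug moves along the shorter arc toward a target whose polar angle
exceeds its own by `x`: `+1` is counterclockwise, `-1` is clockwise, and `0` means that the target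
is at the same point or at the antipodal point. -/
def direction (x : ℝ) : ℝ :=
  if angleMod x ∈ Ioo 0 π then 1
  else if angleMod x ∈ Ioo π (2 * π) then -1
  else 0

open Classical in
/-- The angular velocity of bug `j` when the bugs have polar angles `θ i` (the indices are cyclic:
the last bug chases the first one). Consecutive bugs at the same point form a cluster, and a cluster
collectively chases the next bug. So bug `j` moves toward the first bug among `j + 1, j + 2, …` that
is not at the point where bug `j` is (`k = 0` never qualifies below). This is bug `j + 1` unless
bugs `j` and `j + 1` have met. If all bugs are at one point, they are at rest. -/
def velocity {N : ℕ} [NeZero N] (θ : Fin N → ℝ) (j : Fin N) : ℝ :=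
  if h : ∃ k : ℕ, Circle.exp (θ (j + Fin.ofNat N k)) ≠ Circle.exp (θ j) then
    direction (θ (j + Fin.ofNat N (Nat.find h)) - θ j)
  else 0

/-- `θ` describes a motion of the `N` bugs for all times `t ≥ 0` that starts at `θ₀`: at time `t`,
bug `j` is at the point `exp (i θ t j)` of the unit circle, and `θ` solves the equations of
motion `dθ_j/dt = velocity θ j` in the sense of Carathéodory (the right-hand side is discontinuous).
The angles `θ t j` are continuous lifts and are not reduced modulo `2π`. -/
structure IsPursuit {N : ℕ} [NeZero N] (θ₀ : Fin N → ℝ) (θ : ℝ → Fin N → ℝ) : Prop where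
  initial : θ 0 = θ₀
  integrable : ∀ j, ∀ t, 0 ≤ t → IntervalIntegrable (fun s => velocity (θ s) j) volume 0 t
  motion : ∀ j, ∀ t, 0 ≤ t → θ t j = θ₀ j + ∫ s in (0 : ℝ)..t, velocity (θ s) j

/-- From some time on, all bugs move in the same direction forever. -/
def EntersCycle {N : ℕ} [NeZero N] (θ : ℝ → Fin N → ℝ) : Prop :=
  ∃ T, 0 ≤ T ∧
    ((∀ t, T ≤ t → ∀ j, velocity (θ t) j = 1) ∨ (∀ t, T ≤ t → ∀ j, velocity (θ t) j = -1))

/-- From some time on, all bugs stay at one and the same point of the circle. -/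
def EntersCoalescence {N : ℕ} (θ : ℝ → Fin N → ℝ) : Prop :=
  ∃ T, 0 ≤ T ∧ ∃ z : Circle, ∀ t, T ≤ t → ∀ j, Circle.exp (θ t j) = z

/-- Bugs that start at `θ₀` end in a cycle state. -/
def Cycles {N : ℕ} [NeZero N] (θ₀ : Fin N → ℝ) : Prop :=
  ∃ θ, IsPursuit θ₀ θ ∧ EntersCycle θ

/-- Bugs that start at `θ₀` coalesce. -/
def Coalesces {N : ℕ} [NeZero N] (θ₀ : Fin N → ℝ) : Prop :=
  ∃ θ, IsPursuit θ₀ θ ∧ EntersCoalescence θ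

end

/-! Almost surely no bug is antipodal to its successor, so the signed gaps δ_j along the shorter
arcs lie in (-π, π). A chasing bug runs at full speed and its target is no faster, so |δ_j| never
grows (`IsPursuit.abs_transportGaps_le`). No gap ever reaches ±π, and the sum of the gaps, which is
2π times a winding number, is conserved. It decides the fate: all gaps vanish at coalescence, while
in a cycle state they have one sign and are not all zero.

Solutions exist because velocities stay constant until some gap closes, and closed gaps stay closed
(`HasGaps.exists_isPursuit`). They are unique because the gaps of two solutions contract in ℓ¹
(`HasGaps.deriv_abs_sub_le`).

For four bugs the winding number is -1, 0 or 1, so the squared sum is 4π² in the cycle case and 0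
otherwise. The cycle probability is thus the second moment of the sum divided by 4π². Each gap is
uniform on [-π, π) with second moment π²/3, and distinct gaps are uncorrelated, so this is
(4π²/3)/(4π²) = 1/3. -/

/-! ### Velocities in a fixed configuration -/

theorem direction_add_int_mul (x : ℝ) (m : ℤ) : direction (x + m * (2 * π)) = direction x := by
  have h : angleMod (x + m * (2 * π)) = angleMod x := by
    unfold angleMod
    rw [← zsmul_eq_mul, toIcoMod_add_zsmul]
  unfold direction
  rw [h]

theorem direction_eq_sign {g : ℝ} (hg : |g| < π) : direction g = Real.sign g := by
  obtain ⟨h1, h2⟩ := abs_lt.1 hg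
  have hπ := Real.pi_pos
  rcases lt_trichotomy g 0 with h | h | h
  · have : angleMod g = g + 2 * π := by
      unfold angleMod
      rw [toIcoMod_eq_iff]
      exact ⟨⟨by linarith, by linarith⟩, -1, by simp⟩
    rw [Real.sign_of_neg h, direction, this, if_neg, if_pos]
    · exact ⟨by linarith, by linarith⟩
    · exact fun hh => by linarith [hh.2]
  · have : angleMod g = 0 := by
      unfold angleMod
      rw [toIcoMod_eq_iff]
      exact ⟨⟨by linarith, by linarith⟩, 0, by simp [h]⟩
    rw [direction, this, h, Real.sign_zero, if_neg (by simp), if_neg]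
    exact fun hh => by linarith [hh.1]
  · have : angleMod g = g := by
      unfold angleMod
      rw [toIcoMod_eq_iff]
      exact ⟨⟨by linarith, by linarith⟩, 0, by simp⟩
    rw [Real.sign_of_pos h, direction, this, if_pos ⟨h, h2⟩]

theorem abs_direction_le_one (x : ℝ) : |direction x| ≤ 1 := by
  unfold direction
  split_ifs <;> simp

theorem abs_velocity_le_one {N : ℕ} [NeZero N] (θ : Fin N → ℝ) (j : Fin N) :
    |velocity θ j| ≤ 1 := by
  unfold velocity
  split_ifs
  · exact abs_direction_le_one _
  · simp

theorem velocity_eq_zero_or {N : ℕ} [NeZero N] (θ : Fin N → ℝ) (j : Fin N) :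
    velocity θ j = 0 ∨ velocity θ j = 1 ∨ velocity θ j = -1 := by
  unfold velocity direction
  split_ifs <;> simp

theorem velocity_eq_direction {N : ℕ} [NeZero N] {θ : Fin N → ℝ} {j : Fin N}
    (h : Circle.exp (θ (j + 1)) ≠ Circle.exp (θ j)) :
    velocity θ j = direction (θ (j + 1) - θ j) := by
  classical
  have h1 : j + Fin.ofNat N 1 = j + 1 := rfl
  have hex : ∃ k : ℕ, Circle.exp (θ (j + Fin.ofNat N k)) ≠ Circle.exp (θ j) := ⟨1, by rwa [h1]⟩
  have hfind : Nat.find hex = 1 := by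
    rw [Nat.find_eq_iff]
    refine ⟨by rwa [h1], fun n hn => ?_⟩
    obtain rfl : n = 0 := by omega
    simp
  rw [velocity, dif_pos hex]
  have : ∀ n, n = 1 → direction (θ (j + Fin.ofNat N n) - θ j) = direction (θ (j + 1) - θ j) := by
    rintro n rfl
    rw [h1]
  exact this _ (by convert hfind)

theorem Fin.add_ofNat_succ {N : ℕ} [NeZero N] (j : Fin N) (k : ℕ) :
    j + Fin.ofNat N (k + 1) = j + 1 + Fin.ofNat N k := by
  have : Fin.ofNat N (k + 1) = 1 + Fin.ofNat N k := by
    apply Fin.ext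
    simp [Fin.val_add, Fin.ofNat, add_comm]
  rw [this, add_assoc]

/-- The search for a target from `j` fails at its first step and then coincides with the search from
`j + 1`. This is how a cluster inherits the velocity of its leader. -/
theorem velocity_eq_velocity_succ {N : ℕ} [NeZero N] {θ : Fin N → ℝ} {j : Fin N}
    (h : Circle.exp (θ (j + 1)) = Circle.exp (θ j)) : velocity θ j = velocity θ (j + 1) := by
  classical
  by_cases hex : ∃ k : ℕ, Circle.exp (θ (j + 1 + Fin.ofNat N k)) ≠ Circle.exp (θ (j + 1))
  · have hex' : ∃ k : ℕ, Circle.exp (θ (j + Fin.ofNat N k)) ≠ Circle.exp (θ j) := by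
      obtain ⟨k, hk⟩ := hex
      exact ⟨k + 1, by rwa [Fin.add_ofNat_succ, ← h]⟩
    have hfind : Nat.find hex' = Nat.find hex + 1 := by
      rw [Nat.find_eq_iff]
      refine ⟨?_, fun n hn => ?_⟩
      · rw [Fin.add_ofNat_succ, ← h]
        exact Nat.find_spec hex
      · rcases n with _ | n
        · simp
        · rw [Fin.add_ofNat_succ, ← h]
          exact Nat.find_min hex (by omega)
    rw [velocity, velocity, dif_pos hex, dif_pos hex']
    obtain ⟨m, hm⟩ := Circle.exp_eq_exp.1 h
    have : ∀ n n', n' = n + 1 → direction (θ (j + Fin.ofNat N n') - θ j)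
        = direction (θ (j + 1 + Fin.ofNat N n) - θ (j + 1)) := by
      rintro n n' rfl
      rw [Fin.add_ofNat_succ, ← direction_add_int_mul (_ - θ (j + 1)) m]
      congr 1
      linarith
    exact this _ _ (by convert hfind)
  · have hex' : ¬ ∃ k : ℕ, Circle.exp (θ (j + Fin.ofNat N k)) ≠ Circle.exp (θ j) := by
      rintro ⟨k, hk⟩
      rcases k with _ | k
      · simp at hk
      · exact hex ⟨k, by rwa [Fin.add_ofNat_succ, ← h] at hk⟩
    rw [velocity, velocity, dif_neg hex, dif_neg hex']

theorem velocity_eq_sign_of_abs_lt {N : ℕ} [NeZero N] {θ : Fin N → ℝ} {j : Fin N} {g : ℝ} {m : ℤ}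
    (hg : |g| < π) (hm : θ (j + 1) - θ j = g + m * (2 * π)) (h0 : g ≠ 0) :
    velocity θ j = Real.sign g := by
  rw [velocity_eq_direction, hm, direction_add_int_mul, direction_eq_sign hg]
  intro h
  obtain ⟨n, hn⟩ := Circle.exp_eq_exp.1 h
  have h1 : g = (n - m : ℤ) * (2 * π) := by push_cast; linarith
  have hπ := Real.pi_pos
  have h2 : |((n - m : ℤ) : ℝ)| < 1 := by
    rw [h1, abs_mul, abs_of_pos Real.two_pi_pos] at hg
    nlinarith
  have h3 : n - m = 0 := by
    rw [← Int.abs_lt_one_iff]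
    exact_mod_cast h2
  rw [h3] at h1
  simp [h1] at h0

/-! ### Signed gaps and the velocities they determine -/

/-- `δ j` is the signed length of the shorter arc from bug `j` to bug `j + 1`; in particular no bug
is antipodal to the next one. -/
def HasGaps {N : ℕ} [NeZero N] (θ δ : Fin N → ℝ) : Prop :=
  ∀ j, |δ j| < π ∧ ∃ m : ℤ, θ (j + 1) - θ j = δ j + m * (2 * π)

namespace HasGaps

variable {N : ℕ} [NeZero N] {θ θ' δ δ' : Fin N → ℝ} {j : Fin N}

theorem velocity_eq_sign (h : HasGaps θ δ) (hj : δ j ≠ 0) : velocity θ j = Real.sign (δ j) :=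
  let ⟨hlt, _, hm⟩ := h j
  velocity_eq_sign_of_abs_lt hlt hm hj

theorem exp_eq (h : HasGaps θ δ) (hj : δ j = 0) :
    Circle.exp (θ (j + 1)) = Circle.exp (θ j) := by
  obtain ⟨-, m, hm⟩ := h j
  exact Circle.exp_eq_exp.2 ⟨m, by linarith⟩

theorem velocity_of_pos (h : HasGaps θ δ) (hj : 0 < δ j) : velocity θ j = 1 := by
  rw [h.velocity_eq_sign hj.ne', Real.sign_of_pos hj]

theorem velocity_of_neg (h : HasGaps θ δ) (hj : δ j < 0) : velocity θ j = -1 := by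
  rw [h.velocity_eq_sign hj.ne, Real.sign_of_neg hj]

theorem velocity_succ (h : HasGaps θ δ) (hj : δ j = 0) : velocity θ j = velocity θ (j + 1) :=
  velocity_eq_velocity_succ (h.exp_eq hj)

end HasGaps

theorem Fin.apply_eq_of_apply_add_one {N : ℕ} [NeZero N] {α : Type*} {f : Fin N → α}
    (h : ∀ j, f (j + 1) = f j) (i j : Fin N) : f i = f j := by
  have key : ∀ (k : ℕ) (i : Fin N), f (i + Fin.ofNat N k) = f i := by
    intro k
    induction k with
    | zero => simp
    | succ k ih => intro i; rw [Fin.add_ofNat_succ, ih, h]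
  have := key (j - i).val i
  rw [Fin.ofNat_val_eq_self, add_sub_cancel] at this
  exact this.symm

namespace HasGaps

variable {N : ℕ} [NeZero N] {θ θ' δ δ' : Fin N → ℝ} {j : Fin N}

theorem exp_eq_of_forall_eq_zero (h : HasGaps θ δ) (h0 : ∀ j, δ j = 0) (i j : Fin N) :
    Circle.exp (θ i) = Circle.exp (θ j) :=
  Fin.apply_eq_of_apply_add_one (f := fun i => Circle.exp (θ i))
    (fun j => h.exp_eq (h0 j)) i j

theorem velocity_eq_zero (h : HasGaps θ δ) (h0 : ∀ j, δ j = 0) : velocity θ j = 0 := by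
  rw [velocity, dif_neg]
  rintro ⟨k, hk⟩
  exact hk (h.exp_eq_of_forall_eq_zero h0 _ _)

/-- A nonzero gap forces speed 1, so a resting bug has met its successor, which then rests too; this
propagates around the cycle. -/
theorem eq_zero_of_velocity_eq_zero (h : HasGaps θ δ) (hj : velocity θ j = 0) (i : Fin N) :
    δ i = 0 := by
  have h1 : ∀ i, velocity θ i = 0 → δ i = 0 := by
    intro i hi
    by_contra hne
    rcases lt_or_gt_of_ne hne with hl | hl
    · rw [h.velocity_of_neg hl] at hi; norm_num at hi
    · rw [h.velocity_of_pos hl] at hi; norm_num at hi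
  have h2 : ∀ (k : ℕ) (i : Fin N), velocity θ i = 0 → velocity θ (i + Fin.ofNat N k) = 0 := by
    intro k
    induction k with
    | zero => intro i hi; simpa using hi
    | succ k ih =>
      intro i hi
      rw [Fin.add_ofNat_succ]
      exact ih _ (by rw [← h.velocity_succ (h1 i hi), hi])
  have := h2 (i - j).val j hj
  rw [Fin.ofNat_val_eq_self, add_sub_cancel] at this
  exact h1 i this

/-- The velocities depend only on the signs of the gaps. -/
theorem velocity_congr (h : HasGaps θ δ) (h' : HasGaps θ' δ')
    (hs : ∀ j, Real.sign (δ j) = Real.sign (δ' j)) (j : Fin N) : velocity θ j = velocity θ' j := by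
  have hz : ∀ j, δ j = 0 ↔ δ' j = 0 := fun j => by
    rw [← Real.sign_eq_zero_iff, hs, Real.sign_eq_zero_iff]
  by_cases hall : ∀ j, δ j = 0
  · rw [h.velocity_eq_zero hall, h'.velocity_eq_zero fun j => (hz j).1 (hall j)]
  · push Not at hall
    obtain ⟨i, hi⟩ := hall
    -- Induction on the distance to a nonzero gap: its sign fixes the velocity there, and zero gaps
    -- pass velocities back.
    have key : ∀ (k : ℕ) (j : Fin N), δ (j + Fin.ofNat N k) ≠ 0 →
        velocity θ j = velocity θ' j := by
      intro k
      induction k with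
      | zero =>
        intro j hj
        have hj : δ j ≠ 0 := by simpa using hj
        rw [h.velocity_eq_sign hj, h'.velocity_eq_sign fun hh => hj ((hz j).2 hh), hs]
      | succ k ih =>
        intro j hj
        by_cases h0 : δ j = 0
        · rw [h.velocity_succ h0, h'.velocity_succ ((hz j).1 h0)]
          exact ih _ (by rwa [← Fin.add_ofNat_succ])
        · rw [h.velocity_eq_sign h0, h'.velocity_eq_sign fun hh => h0 ((hz j).2 hh), hs]
    refine key (i - j).val j ?_
    rwa [Fin.ofNat_val_eq_self, add_sub_cancel]

/-- The velocities are monotone in the gaps at a bug whose gaps differ. -/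
theorem velocity_le_of_lt (h : HasGaps θ δ) (h' : HasGaps θ' δ') (hj : δ' j < δ j) :
    velocity θ' j ≤ velocity θ j := by
  rcases lt_or_ge 0 (δ j) with h0 | h0
  · rw [h.velocity_of_pos h0]
    exact (abs_le.1 (abs_velocity_le_one θ' j)).2
  · rw [h'.velocity_of_neg (hj.trans_le h0)]
    exact (abs_le.1 (abs_velocity_le_one θ j)).1

end HasGaps

/-! ### Differential inequalities and regularity of solutions -/

/-- The bound is asked only of derivatives that exist. At a kink of an absolute value or a
truncation, such a derivative is zero because the point is a local extremum. -/
theorem AbsolutelyContinuousOnInterval.sub_le_integral {f φ : ℝ → ℝ} {T : ℝ} (hT : 0 ≤ T)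
    (hf : AbsolutelyContinuousOnInterval f 0 T) (hφ : IntervalIntegrable φ volume 0 T)
    (h : ∀ᵐ t, t ∈ Ioo 0 T → ∀ d, HasDerivAt f d t → d ≤ φ t) :
    f T - f 0 ≤ ∫ t in (0 : ℝ)..T, φ t := by
  rw [← hf.integral_deriv_eq_sub]
  refine intervalIntegral.integral_mono_ae_restrict hT hf.intervalIntegrable_deriv hφ ?_
  rw [Filter.EventuallyLE, ← restrict_Ioo_eq_restrict_Icc, ae_restrict_iff' measurableSet_Ioo]
  filter_upwards [h, hf.ae_differentiableAt] with t h1 h2 ht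
  refine h1 ht _ (h2 ?_).hasDerivAt
  rw [uIcc_of_le hT]
  exact Ioo_subset_Icc_self ht

namespace IsPursuit

variable {N : ℕ} [NeZero N] {θ₀ δ₀ : Fin N → ℝ} {θ θ' : ℝ → Fin N → ℝ}

theorem lipschitzOnWith (h : IsPursuit θ₀ θ) (j : Fin N) :
    LipschitzOnWith 1 (fun t => θ t j) (Ici 0) := by
  refine LipschitzOnWith.of_dist_le_mul fun s hs t ht => ?_
  rw [mem_Ici] at hs ht
  have : θ s j - θ t j = ∫ r in t..s, velocity (θ r) j := by
    rw [h.motion j s hs, h.motion j t ht,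
      ← intervalIntegral.integral_interval_sub_left (h.integrable j s hs) (h.integrable j t ht)]
    ring
  rw [Real.dist_eq, this, ← Real.norm_eq_abs, Real.dist_eq]
  exact intervalIntegral.norm_integral_le_of_norm_le_const fun r _ => abs_velocity_le_one _ _

theorem ae_hasDerivAt (h : IsPursuit θ₀ θ) (T : ℝ) :
    ∀ᵐ t, t ∈ Ioo 0 T → ∀ j, HasDerivAt (fun t => θ t j) (velocity (θ t) j) t := by
  by_cases hT : 0 ≤ T
  · have h1 := ae_all_iff.2 fun j => (h.integrable j T hT).ae_hasDerivAt_integral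
    filter_upwards [h1] with t ht hmem j
    have h2 := ((ht j (by rw [uIcc_of_le hT]; exact Ioo_subset_Icc_self hmem) 0
      left_mem_uIcc).const_add (θ₀ j))
    refine h2.congr_of_eventuallyEq ?_
    filter_upwards [Ioi_mem_nhds hmem.1] with s hs
    exact h.motion j s (le_of_lt hs)
  · exact Filter.Eventually.of_forall fun t ht => absurd (ht.1.trans ht.2).le hT

end IsPursuit

/-! ### Gaps along a motion: conserved sum, nonincreasing size -/

/-- The gaps at a later position `θ₁` of bugs that have moved continuously from a position `θ₀`
with gaps `δ₀`, as long as no gap has reached `±π`. -/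
def transportGaps {N : ℕ} [NeZero N] (θ₀ δ₀ θ₁ : Fin N → ℝ) (j : Fin N) : ℝ :=
  δ₀ j + (θ₁ (j + 1) - θ₀ (j + 1)) - (θ₁ j - θ₀ j)

theorem Fin.sum_add_one {N : ℕ} [NeZero N] (f : Fin N → ℝ) : ∑ j, f (j + 1) = ∑ j, f j :=
  Equiv.sum_comp (Equiv.addRight 1) f

theorem sum_transportGaps {N : ℕ} [NeZero N] (θ₀ δ₀ θ₁ : Fin N → ℝ) :
    ∑ j, transportGaps θ₀ δ₀ θ₁ j = ∑ j, δ₀ j := by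
  simp only [transportGaps, Finset.sum_sub_distrib, Finset.sum_add_distrib]
  rw [Fin.sum_add_one θ₁, Fin.sum_add_one θ₀]
  ring

theorem HasGaps.transport {N : ℕ} [NeZero N] {θ₀ δ₀ θ₁ : Fin N → ℝ} (h : HasGaps θ₀ δ₀)
    (hlt : ∀ j, |transportGaps θ₀ δ₀ θ₁ j| < π) : HasGaps θ₁ (transportGaps θ₀ δ₀ θ₁) := by
  intro j
  obtain ⟨-, m, hm⟩ := h j
  exact ⟨hlt j, m, by unfold transportGaps; linarith⟩

namespace IsPursuit

variable {N : ℕ} [NeZero N] {θ₀ δ₀ : Fin N → ℝ} {θ θ' : ℝ → Fin N → ℝ}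

theorem lipschitzOnWith_transportGaps (h : IsPursuit θ₀ θ) (j : Fin N) :
    LipschitzOnWith 2 (fun t => transportGaps θ₀ δ₀ (θ t) j) (Ici 0) := by
  have h1 := (h.lipschitzOnWith (j + 1)).sub (h.lipschitzOnWith j)
  rw [one_add_one_eq_two] at h1
  refine LipschitzOnWith.of_dist_le_mul fun s hs t ht => ?_
  have h2 := h1.dist_le_mul s hs t ht
  convert h2 using 1
  simp only [transportGaps, Real.dist_eq]
  congr 1
  ring

theorem abs_transportGaps_le (h : IsPursuit θ₀ θ) (h₀ : HasGaps θ₀ δ₀) (j : Fin N) {T : ℝ}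
    (hT : 0 ≤ T) : |transportGaps θ₀ δ₀ (θ T) j| ≤ |δ₀ j| := by
  obtain ⟨hc, m, hm⟩ := h₀ j
  obtain ⟨b, hcb, hb⟩ := exists_between hc
  set g : ℝ → ℝ := fun t => transportGaps θ₀ δ₀ (θ t) j with hg
  have hg0 : g 0 = δ₀ j := by simp [hg, transportGaps, h.initial]
  set c := |δ₀ j| with hcdef
  have hc0 : 0 ≤ c := abs_nonneg _
  -- Truncating at b < π avoids circularity: the gap is known to govern the velocity only while |g|
  -- < π. Outside c < |g| < b the function ψ ∘ g is at a global extremum; inside, bug `j` pursues at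
  -- speed 1 a target of speed at most 1.
  set ψ : ℝ → ℝ := fun x => max c (min |x| b) with hψ
  have hψL : LipschitzWith 1 ψ :=
    ((lipschitzWith_one_norm (E := ℝ)).min_const b).const_max c
  have hac : AbsolutelyContinuousOnInterval (ψ ∘ g) 0 T := by
    have := (hψL.comp_lipschitzOnWith (h.lipschitzOnWith_transportGaps (δ₀ := δ₀) j)).mono
      (t := Ici 0) (s := uIcc 0 T) (by rw [uIcc_of_le hT]; exact Icc_subset_Ici_self)
    exact this.absolutelyContinuousOnInterval
  have key := hac.sub_le_integral hT (φ := fun _ => 0) (by simp) (by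
    filter_upwards [h.ae_hasDerivAt T] with t ht htm d hd
    by_cases h1 : |g t| ≤ c
    · refine (IsLocalMin.hasDerivAt_eq_zero (Filter.Eventually.of_forall fun s => ?_) hd).le
      have : ψ (g t) = c := max_eq_left ((min_le_left _ _).trans h1)
      simp only [Function.comp, this]
      exact le_max_left _ _
    by_cases h2 : b ≤ |g t|
    · refine (IsLocalMax.hasDerivAt_eq_zero (Filter.Eventually.of_forall fun s => ?_) hd).le
      have : ψ (g t) = b := by simp only [hψ]; rw [min_eq_right h2, max_eq_right hcb.le]
      simp only [Function.comp, this]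
      exact max_le hcb.le (min_le_right _ _)
    push Not at h1 h2
    have hgd : HasDerivAt g (velocity (θ t) (j + 1) - velocity (θ t) j) t :=
      ((((ht htm (j + 1)).sub_const _).const_add _).sub ((ht htm j).sub_const _))
    have hg0 : g t ≠ 0 := by
      intro h0
      rw [h0, abs_zero] at h1
      linarith
    have hv := velocity_eq_sign_of_abs_lt (θ := θ t) (j := j) (g := g t) (m := m)
      (h2.trans hb) (by simp only [hg, transportGaps]; linarith) hg0
    have hb1 := abs_le.1 (abs_velocity_le_one (θ t) (j + 1))
    have hev : ∀ᶠ s in nhds t, (ψ ∘ g) s = |g s| := by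
      have hcont : ContinuousAt (fun s => |g s|) t := hgd.continuousAt.abs
      filter_upwards [hcont.eventually (lt_mem_nhds h1), hcont.eventually (gt_mem_nhds h2)]
        with s hs1 hs2
      simp only [Function.comp, hψ]
      rw [min_eq_left hs2.le, max_eq_right hs1.le]
    rcases lt_or_gt_of_ne hg0 with hneg | hpos
    · have hev2 : ∀ᶠ s in nhds t, (ψ ∘ g) s = - g s := by
        filter_upwards [hev, hgd.continuousAt.eventually (gt_mem_nhds hneg)] with s hs1 hs2
        rw [hs1, abs_of_neg hs2]
      have := hd.unique (hgd.neg.congr_of_eventuallyEq hev2)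
      rw [this, hv, Real.sign_of_neg hneg]
      linarith
    · have hev2 : ∀ᶠ s in nhds t, (ψ ∘ g) s = g s := by
        filter_upwards [hev, hgd.continuousAt.eventually (lt_mem_nhds hpos)] with s hs1 hs2
        rw [hs1, abs_of_pos hs2]
      have := hd.unique (hgd.congr_of_eventuallyEq hev2)
      rw [this, hv, Real.sign_of_pos hpos]
      linarith)
  have h0 : ψ (g 0) = c := by
    rw [hg0]
    exact max_eq_left (min_le_left _ _)
  simp only [Function.comp, h0, intervalIntegral.integral_zero] at key
  have h1 : min |g T| b ≤ c := (le_max_right _ _).trans (by linarith : ψ (g T) ≤ c)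
  rcases min_le_iff.1 h1 with h2 | h2
  · exact h2
  · linarith

theorem hasGaps (h : IsPursuit θ₀ θ) (h₀ : HasGaps θ₀ δ₀) {t : ℝ} (ht : 0 ≤ t) :
    HasGaps (θ t) (transportGaps θ₀ δ₀ (θ t)) :=
  h₀.transport fun j => (h.abs_transportGaps_le h₀ j ht).trans_lt (h₀ j).1

end IsPursuit

/-! ### Uniqueness by ℓ¹ contraction -/

/-- Pointwise form of the fact that the gaps of two pursuits contract in the `ℓ¹` distance. -/
theorem HasGaps.deriv_abs_sub_le {N : ℕ} [NeZero N] {θ θ' : Fin N → ℝ} {D : ℝ → ℝ} {d t : ℝ}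
    {δ δ' : Fin N → ℝ} {j : Fin N} (h : HasGaps θ δ) (h' : HasGaps θ' δ')
    (hD : HasDerivAt D (velocity θ (j + 1) - velocity θ j
      - (velocity θ' (j + 1) - velocity θ' j)) t)
    (hDt : D t = δ j - δ' j) (hd : HasDerivAt (fun s => |D s|) d t) :
    d ≤ |velocity θ (j + 1) - velocity θ' (j + 1)| - |velocity θ j - velocity θ' j| := by
  -- If D t ≠ 0, monotonicity makes the velocity difference of bug `j` agree in sign with D t, so it
  -- contributes minus its absolute value. If D t = 0, the gaps agree: either both bugs copy their
  -- successors or both velocities equal the same sign.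
  rcases lt_trichotomy (D t) 0 with hneg | h0 | hpos
  · have hev : ∀ᶠ s in nhds t, |D s| = - D s := by
      filter_upwards [hD.continuousAt.eventually (gt_mem_nhds hneg)] with s hs
      rw [abs_of_neg hs]
    have := hd.unique (hD.neg.congr_of_eventuallyEq hev)
    have h1 := h'.velocity_le_of_lt h (j := j) (by linarith)
    rw [this, abs_of_nonpos (a := velocity θ j - velocity θ' j) (by linarith)]
    have := neg_le_abs (velocity θ (j + 1) - velocity θ' (j + 1))
    linarith
  · have hd0 : d = 0 := by
      refine IsLocalMin.hasDerivAt_eq_zero (Filter.Eventually.of_forall fun s => ?_) hd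
      simp only [h0, abs_zero]
      exact abs_nonneg _
    rw [hd0, sub_nonneg]
    have hδ : δ j = δ' j := by linarith
    by_cases hz : δ j = 0
    · rw [h.velocity_succ hz, h'.velocity_succ (hδ ▸ hz)]
    · rw [h.velocity_eq_sign hz, h'.velocity_eq_sign (hδ ▸ hz), hδ, sub_self, abs_zero]
      exact abs_nonneg _
  · have hev : ∀ᶠ s in nhds t, |D s| = D s := by
      filter_upwards [hD.continuousAt.eventually (lt_mem_nhds hpos)] with s hs
      rw [abs_of_pos hs]
    have := hd.unique (hD.congr_of_eventuallyEq hev)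
    have h1 := h.velocity_le_of_lt h' (j := j) (by linarith)
    rw [this, abs_of_nonneg (a := velocity θ j - velocity θ' j) (by linarith)]
    have := le_abs_self (velocity θ (j + 1) - velocity θ' (j + 1))
    linarith

namespace IsPursuit

variable {N : ℕ} [NeZero N] {θ₀ δ₀ : Fin N → ℝ} {θ θ' : ℝ → Fin N → ℝ}

theorem transportGaps_unique (h : IsPursuit θ₀ θ) (h' : IsPursuit θ₀ θ') (h₀ : HasGaps θ₀ δ₀)
    {T : ℝ} (hT : 0 ≤ T) (j : Fin N) :
    transportGaps θ₀ δ₀ (θ T) j = transportGaps θ₀ δ₀ (θ' T) j := by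
  set D : Fin N → ℝ → ℝ := fun j t =>
    transportGaps θ₀ δ₀ (θ t) j - transportGaps θ₀ δ₀ (θ' t) j with hD
  have hint : ∀ j, IntervalIntegrable (fun t => |velocity (θ t) j - velocity (θ' t) j|)
      volume 0 T := fun j => ((h.integrable j T hT).sub (h'.integrable j T hT)).abs
  have key : ∀ j, |D j T| ≤ (∫ t in (0 : ℝ)..T, |velocity (θ t) (j + 1) - velocity (θ' t) (j + 1)|)
      - ∫ t in (0 : ℝ)..T, |velocity (θ t) j - velocity (θ' t) j| := by
    intro j
    have hac : AbsolutelyContinuousOnInterval (fun t => |D j t|) 0 T := by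
      have h1 := (h.lipschitzOnWith_transportGaps (δ₀ := δ₀) j).sub
        (h'.lipschitzOnWith_transportGaps (δ₀ := δ₀) j)
      exact (((lipschitzWith_one_norm (E := ℝ)).comp_lipschitzOnWith h1).mono
        (t := Ici 0) (s := uIcc 0 T) (by
          rw [uIcc_of_le hT]; exact Icc_subset_Ici_self)).absolutelyContinuousOnInterval
    have h1 := hac.sub_le_integral hT ((hint (j + 1)).sub (hint j)) (by
      filter_upwards [h.ae_hasDerivAt T, h'.ae_hasDerivAt T] with t ht ht' htm d hd
      refine (h.hasGaps h₀ htm.1.le).deriv_abs_sub_le (h'.hasGaps h₀ htm.1.le) (D := D j) ?_ rfl hd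
      exact ((((ht htm (j + 1)).sub_const _).const_add _).sub ((ht htm j).sub_const _)).sub
        ((((ht' htm (j + 1)).sub_const _).const_add _).sub ((ht' htm j).sub_const _)))
    rw [intervalIntegral.integral_sub (hint (j + 1)) (hint j)] at h1
    have h2 : D j 0 = 0 := by simp [hD, h.initial, h'.initial]
    simpa [h2] using h1
  -- The bounds telescope around the cycle.
  have hsum : ∑ j, |D j T| ≤ 0 := by
    refine (Finset.sum_le_sum fun j _ => key j).trans ?_
    rw [Finset.sum_sub_distrib,
      Fin.sum_add_one fun j => ∫ t in (0 : ℝ)..T, |velocity (θ t) j - velocity (θ' t) j|, sub_self]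
  have h0 := (Finset.sum_eq_zero_iff_of_nonneg fun j _ => abs_nonneg (D j T)).1
    (hsum.antisymm (Finset.sum_nonneg fun j _ => abs_nonneg (D j T))) j (Finset.mem_univ j)
  exact sub_eq_zero.1 (abs_eq_zero.1 h0)

theorem eqOn (h : IsPursuit θ₀ θ) (h' : IsPursuit θ₀ θ') (h₀ : HasGaps θ₀ δ₀) :
    EqOn θ' θ (Ici 0) := by
  intro T hT
  ext j
  rw [h.motion j T hT, h'.motion j T hT]
  congr 1
  refine intervalIntegral.integral_congr fun t ht => ?_
  rw [uIcc_of_le hT] at ht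
  exact (h'.hasGaps h₀ ht.1).velocity_congr (h.hasGaps h₀ ht.1)
    (fun j => by rw [h.transportGaps_unique h' h₀ ht.1]) j

/-! ### The sum of the gaps excludes one of the two final states -/

/-- Common motion in one direction rules out gaps of the opposite sign. A zero sum would then make
every gap zero, and the bugs would be at rest. -/
theorem sum_ne_zero_of_entersCycle (h : IsPursuit θ₀ θ) (h₀ : HasGaps θ₀ δ₀)
    (hc : EntersCycle θ) : ∑ j, δ₀ j ≠ 0 := by
  obtain ⟨T, hT, hc⟩ := hc
  have hg := h.hasGaps h₀ hT
  rw [← sum_transportGaps θ₀ δ₀ (θ T)]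
  intro hs
  have hz : ∀ j, transportGaps θ₀ δ₀ (θ T) j = 0 := by
    rcases hc with hc | hc
    · have h1 : ∀ j, 0 ≤ transportGaps θ₀ δ₀ (θ T) j := by
        intro j
        by_contra! hlt
        have := hg.velocity_of_neg hlt
        rw [hc T le_rfl j] at this
        norm_num at this
      exact fun j => (Finset.sum_eq_zero_iff_of_nonneg fun j _ => h1 j).1 hs j (Finset.mem_univ j)
    · have h1 : ∀ j, transportGaps θ₀ δ₀ (θ T) j ≤ 0 := by
        intro j
        by_contra! hlt
        have := hg.velocity_of_pos hlt
        rw [hc T le_rfl j] at this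
        norm_num at this
      exact fun j => (Finset.sum_eq_zero_iff_of_nonpos fun j _ => h1 j).1 hs j (Finset.mem_univ j)
  have h0 := hg.velocity_eq_zero hz (j := 0)
  rcases hc with hc | hc <;> · rw [hc T le_rfl] at h0; norm_num at h0

theorem sum_eq_zero_of_entersCoalescence (h : IsPursuit θ₀ θ) (h₀ : HasGaps θ₀ δ₀)
    (hc : EntersCoalescence θ) : ∑ j, δ₀ j = 0 := by
  obtain ⟨T, hT, z, hc⟩ := hc
  have hg := h.hasGaps h₀ hT
  rw [← sum_transportGaps θ₀ δ₀ (θ T)]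
  refine Finset.sum_eq_zero fun j _ => hg.eq_zero_of_velocity_eq_zero (j := j) ?_ j
  rw [velocity, dif_neg]
  rintro ⟨k, hk⟩
  exact hk (by rw [hc T le_rfl, hc T le_rfl])

end IsPursuit

/-! ### Existence by moving from collision to collision -/

theorem IsPursuit.concat {N : ℕ} [NeZero N] {θ₀ v : Fin N → ℝ} {τ : ℝ} {θ : ℝ → Fin N → ℝ}
    (hτ : 0 ≤ τ) (hv : ∀ t ∈ Ico 0 τ, velocity (θ₀ + t • v) = v)
    (h : IsPursuit (θ₀ + τ • v) θ) :
    IsPursuit θ₀ (fun t => if t < τ then θ₀ + t • v else θ (t - τ)) := by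
  set η : ℝ → Fin N → ℝ := fun t => if t < τ then θ₀ + t • v else θ (t - τ) with hη
  have hle : ∀ t, 0 ≤ t → t ≤ τ → ∀ j,
      (fun _ => v j) =ᵐ[volume.restrict (uIoc 0 t)] fun s => velocity (η s) j := by
    intro t h0 ht j
    rw [uIoc_of_le h0, ← restrict_Ioo_eq_restrict_Ioc]
    refine (ae_restrict_iff' measurableSet_Ioo).2 (Filter.Eventually.of_forall fun s hs => ?_)
    have : s < τ := hs.2.trans_le ht
    simp only [hη, if_pos this]
    rw [hv s ⟨hs.1.le, this⟩]
  have hge : ∀ s, τ ≤ s → velocity (η s) = velocity (θ (s - τ)) := fun s hs => by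
    simp only [hη, if_neg hs.not_gt]
  have hint1 : ∀ t, 0 ≤ t → t ≤ τ → ∀ j,
      IntervalIntegrable (fun s => velocity (η s) j) volume 0 t := fun t h0 ht j =>
    (intervalIntegrable_const (c := v j)).congr_ae (hle t h0 ht j)
  have hval1 : ∀ t, 0 ≤ t → t ≤ τ → ∀ j, ∫ s in (0 : ℝ)..t, velocity (η s) j = t * v j := by
    intro t h0 ht j
    rw [← intervalIntegral.integral_congr_ae_restrict (hle t h0 ht j)]
    simp
  have hint2 : ∀ t, τ ≤ t → ∀ j, IntervalIntegrable (fun s => velocity (η s) j) volume τ t := by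
    intro t ht j
    have := (h.integrable j (t - τ) (by linarith)).comp_sub_right τ
    rw [zero_add, sub_add_cancel] at this
    refine this.congr fun s hs => ?_
    rw [uIoc_of_le ht] at hs
    simp only [hge s hs.1.le]
  have hval2 : ∀ t, τ ≤ t → ∀ j, ∫ s in τ..t, velocity (η s) j
      = ∫ s in (0 : ℝ)..(t - τ), velocity (θ s) j := by
    intro t ht j
    have := intervalIntegral.integral_comp_sub_right (a := τ) (b := t)
      (fun s => velocity (θ s) j) τ
    rw [sub_self] at this
    rw [← this]
    refine intervalIntegral.integral_congr fun s hs => ?_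
    rw [uIcc_of_le ht] at hs
    simp only [hge s hs.1]
  refine ⟨?_, fun j t ht => ?_, fun j t ht => ?_⟩
  · rcases hτ.eq_or_lt with h0 | h0
    · simp only [hη, ← h0, lt_irrefl, if_false, sub_zero, h.initial]
      simp
    · simp [hη, h0]
  · rcases le_total t τ with h1 | h1
    · exact hint1 t ht h1 j
    · exact (hint1 τ hτ le_rfl j).trans (hint2 t h1 j)
  · rcases lt_or_ge t τ with h1 | h1
    · rw [hval1 t ht h1.le]
      simp [hη, h1]
    · rw [← intervalIntegral.integral_add_adjacent_intervals (hint1 τ hτ le_rfl j) (hint2 t h1 j),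
        hval1 τ hτ le_rfl, hval2 t h1]
      simp only [hη, if_neg h1.not_gt]
      rw [h.motion j _ (by linarith)]
      simp
      ring

theorem IsPursuit.of_velocity_eq {N : ℕ} [NeZero N] {θ₀ v : Fin N → ℝ}
    (hv : ∀ t : ℝ, 0 ≤ t → velocity (θ₀ + t • v) = v) :
    IsPursuit θ₀ (fun t => θ₀ + t • v) := by
  have hc : ∀ j (t : ℝ), 0 ≤ t →
      EqOn (fun _ => v j) (fun s => velocity (θ₀ + s • v) j) (uIcc 0 t) := by
    intro j t ht s hs
    rw [uIcc_of_le ht] at hs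
    simp only [hv s hs.1]
  refine ⟨by simp, fun j t ht => ?_, fun j t ht => ?_⟩
  · exact (intervalIntegrable_const (c := v j)).congr fun s hs =>
      hc j t ht (uIoc_subset_uIcc hs)
  · rw [← intervalIntegral.integral_congr (hc j t ht)]
    simp

theorem EntersCycle.concat {N : ℕ} [NeZero N] {θ : ℝ → Fin N → ℝ} {τ : ℝ} (hτ : 0 ≤ τ)
    (h : EntersCycle θ) (η : ℝ → Fin N → ℝ) :
    EntersCycle (fun t => if t < τ then η t else θ (t - τ)) := by
  obtain ⟨T, hT, h⟩ := h
  refine ⟨T + τ, by linarith, h.imp (fun h t ht j => ?_) (fun h t ht j => ?_)⟩ <;>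
  · simp only [if_neg (by linarith : ¬ t < τ)]
    exact h _ (by linarith) j

theorem EntersCoalescence.concat {N : ℕ} {θ : ℝ → Fin N → ℝ} {τ : ℝ} (hτ : 0 ≤ τ)
    (h : EntersCoalescence θ) (η : ℝ → Fin N → ℝ) :
    EntersCoalescence (fun t => if t < τ then η t else θ (t - τ)) := by
  obtain ⟨T, hT, z, h⟩ := h
  refine ⟨T + τ, by linarith, z, fun t ht j => ?_⟩
  simp only [if_neg (by linarith : ¬ t < τ)]
  exact h _ (by linarith) j

theorem transportGaps_add_smul {N : ℕ} [NeZero N] (θ₀ δ₀ v : Fin N → ℝ) (t : ℝ) (j : Fin N) :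
    transportGaps θ₀ δ₀ (θ₀ + t • v) j = δ₀ j + t * (v (j + 1) - v j) := by
  simp [transportGaps]
  ring

namespace HasGaps

variable {N : ℕ} [NeZero N] {θ₀ δ₀ : Fin N → ℝ}

theorem transportGaps_of_velocity_eq (t : ℝ) {j : Fin N}
    (hj : velocity θ₀ (j + 1) = velocity θ₀ j) :
    transportGaps θ₀ δ₀ (θ₀ + t • velocity θ₀) j = δ₀ j := by
  rw [transportGaps_add_smul, hj]
  simp

/-- A bug that moves in another direction than the next one approaches it with speed `2`. -/
theorem transportGaps_of_velocity_ne (h : HasGaps θ₀ δ₀) (t : ℝ) {j : Fin N}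
    (hj : velocity θ₀ (j + 1) ≠ velocity θ₀ j) :
    δ₀ j ≠ 0 ∧
      transportGaps θ₀ δ₀ (θ₀ + t • velocity θ₀) j = Real.sign (δ₀ j) * (|δ₀ j| - 2 * t) := by
  have h0 : δ₀ j ≠ 0 := fun h0 => hj (h.velocity_succ h0).symm
  refine ⟨h0, ?_⟩
  have hn : velocity θ₀ (j + 1) ≠ 0 := fun hz => h0 (h.eq_zero_of_velocity_eq_zero hz j)
  rw [transportGaps_add_smul]
  rcases lt_or_gt_of_ne h0 with hl | hl
  · rw [h.velocity_of_neg hl] at hj ⊢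
    rw [Real.sign_of_neg hl, abs_of_neg hl]
    rcases velocity_eq_zero_or θ₀ (j + 1) with hv | hv | hv
    · exact absurd hv hn
    · rw [hv]; ring
    · exact absurd hv hj
  · rw [h.velocity_of_pos hl] at hj ⊢
    rw [Real.sign_of_pos hl, abs_of_pos hl]
    rcases velocity_eq_zero_or θ₀ (j + 1) with hv | hv | hv
    · exact absurd hv hn
    · exact absurd hv hj
    · rw [hv]; ring

theorem move (h : HasGaps θ₀ δ₀) {t : ℝ} (ht : 0 ≤ t)
    (hle : ∀ j, velocity θ₀ (j + 1) ≠ velocity θ₀ j → 2 * t ≤ |δ₀ j|) :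
    HasGaps (θ₀ + t • velocity θ₀) (transportGaps θ₀ δ₀ (θ₀ + t • velocity θ₀)) := by
  refine h.transport fun j => ?_
  by_cases hj : velocity θ₀ (j + 1) = velocity θ₀ j
  · rw [transportGaps_of_velocity_eq t hj]
    exact (h j).1
  · obtain ⟨h0, h1⟩ := h.transportGaps_of_velocity_ne t hj
    rw [h1, abs_mul, abs_of_nonneg (sub_nonneg.2 (hle j hj))]
    have h2 : |Real.sign (δ₀ j)| ≤ 1 := by
      rcases Real.sign_apply_eq (δ₀ j) with hs | hs | hs <;> simp [hs]
    have h3 := (h j).1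
    have h4 := sub_nonneg.2 (hle j hj)
    nlinarith

theorem velocity_move (h : HasGaps θ₀ δ₀) {t : ℝ} (ht : 0 ≤ t)
    (hlt : ∀ j, velocity θ₀ (j + 1) ≠ velocity θ₀ j → 2 * t < |δ₀ j|) :
    velocity (θ₀ + t • velocity θ₀) = velocity θ₀ := by
  funext j
  refine (h.move ht fun j hj => (hlt j hj).le).velocity_congr h (fun j => ?_) j
  by_cases hj : velocity θ₀ (j + 1) = velocity θ₀ j
  · rw [transportGaps_of_velocity_eq t hj]
  · obtain ⟨h0, h1⟩ := h.transportGaps_of_velocity_ne t hj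
    have h2 := hlt j hj
    rw [h1]
    rcases lt_or_gt_of_ne h0 with hl | hl
    · rw [Real.sign_of_neg hl]
      exact Real.sign_of_neg (by linarith)
    · rw [Real.sign_of_pos hl]
      exact Real.sign_of_pos (by linarith)

/-- Strong induction on the number of nonzero gaps. If all velocities agree, the state is already
final. Otherwise the bugs move uniformly until a gap closes; zero gaps stay zero, so the number
drops. -/
theorem exists_isPursuit (h : HasGaps θ₀ δ₀) :
    ∃ θ, IsPursuit θ₀ θ ∧ (EntersCycle θ ∨ EntersCoalescence θ) := by
  classical
  induction hn : (Finset.univ.filter fun j => δ₀ j ≠ 0).card using Nat.strong_induction_on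
    generalizing θ₀ δ₀ with
  | _ n ih =>
    by_cases hall : ∀ j, velocity θ₀ (j + 1) = velocity θ₀ j
    · have hv : ∀ t : ℝ, 0 ≤ t → velocity (θ₀ + t • velocity θ₀) = velocity θ₀ := fun t ht =>
        h.velocity_move ht fun j hj => absurd (hall j) hj
      have hP := IsPursuit.of_velocity_eq hv
      refine ⟨_, hP, ?_⟩
      have hconst := Fin.apply_eq_of_apply_add_one hall
      rcases velocity_eq_zero_or θ₀ 0 with h0 | h0 | h0
      · refine Or.inr ⟨0, le_rfl, Circle.exp (θ₀ 0), fun t ht j => ?_⟩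
        have hz : velocity θ₀ = 0 := funext fun j => (hconst j 0).trans h0
        simp only [hz, smul_zero, add_zero]
        exact h.exp_eq_of_forall_eq_zero (h.eq_zero_of_velocity_eq_zero h0) j 0
      · exact Or.inl ⟨0, le_rfl, Or.inl fun t ht j => by rw [hv t ht, hconst j 0, h0]⟩
      · exact Or.inl ⟨0, le_rfl, Or.inr fun t ht j => by rw [hv t ht, hconst j 0, h0]⟩
    · push Not at hall
      have hne : (Finset.univ.filter fun j => velocity θ₀ (j + 1) ≠ velocity θ₀ j).Nonempty := by
        obtain ⟨j, hj⟩ := hall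
        exact ⟨j, by simpa using hj⟩
      obtain ⟨i, hi, hmin⟩ := Finset.exists_min_image _ (fun j => |δ₀ j|) hne
      simp only [Finset.mem_filter, Finset.mem_univ, true_and] at hi hmin
      -- Gaps between bugs of different velocities shrink at speed 2, and `i` has the smallest of
      -- them; all other gaps are constant.
      set τ := |δ₀ i| / 2 with hτdef
      have hτ : 0 ≤ τ := by positivity
      have hmove := h.move hτ fun j hj => by
        have := hmin j hj
        linarith
      have hvel : ∀ t ∈ Ico 0 τ, velocity (θ₀ + t • velocity θ₀) = velocity θ₀ := by
        intro t ht
        refine h.velocity_move ht.1 fun j hj => ?_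
        have := hmin j hj
        have := ht.2
        linarith
      have hcard : (Finset.univ.filter fun j =>
          transportGaps θ₀ δ₀ (θ₀ + τ • velocity θ₀) j ≠ 0).card < n := by
        rw [← hn]
        refine Finset.card_lt_card ((Finset.ssubset_iff_of_subset ?_).2 ⟨i, ?_, ?_⟩)
        · intro j
          simp only [Finset.mem_filter, Finset.mem_univ, true_and]
          intro hj h0
          by_cases hv : velocity θ₀ (j + 1) = velocity θ₀ j
          · exact hj (by rw [transportGaps_of_velocity_eq τ hv, h0])
          · exact (h.transportGaps_of_velocity_ne τ hv).1 h0
        · simpa using (h.transportGaps_of_velocity_ne τ hi).1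
        · simp only [Finset.mem_filter, Finset.mem_univ, true_and, not_not]
          rw [(h.transportGaps_of_velocity_ne τ hi).2, hτdef]
          ring
      obtain ⟨θ, hθ, hend⟩ := ih _ hcard hmove rfl
      exact ⟨_, hθ.concat hτ hvel, hend.imp (fun h => h.concat hτ _) (fun h => h.concat hτ _)⟩

theorem cycles_iff (h : HasGaps θ₀ δ₀) : Cycles θ₀ ↔ ∑ j, δ₀ j ≠ 0 := by
  refine ⟨fun ⟨θ, hθ, hc⟩ => hθ.sum_ne_zero_of_entersCycle h hc, fun hs => ?_⟩
  obtain ⟨θ, hθ, hc | hc⟩ := h.exists_isPursuit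
  · exact ⟨θ, hθ, hc⟩
  · exact absurd (hθ.sum_eq_zero_of_entersCoalescence h hc) hs

theorem coalesces_iff (h : HasGaps θ₀ δ₀) : Coalesces θ₀ ↔ ∑ j, δ₀ j = 0 := by
  refine ⟨fun ⟨θ, hθ, hc⟩ => hθ.sum_eq_zero_of_entersCoalescence h hc, fun hs => ?_⟩
  obtain ⟨θ, hθ, hc | hc⟩ := h.exists_isPursuit
  · exact absurd hs (hθ.sum_ne_zero_of_entersCycle h hc)
  · exact ⟨θ, hθ, hc⟩

theorem exists_unique_isPursuit (h : HasGaps θ₀ δ₀) :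
    ∃ θ, IsPursuit θ₀ θ ∧ ∀ θ', IsPursuit θ₀ θ' → EqOn θ' θ (Ici 0) := by
  obtain ⟨θ, hθ, -⟩ := h.exists_isPursuit
  exact ⟨θ, hθ, fun θ' hθ' => hθ.eqOn hθ' h⟩

end HasGaps

/-! ### Signed angles and their integrals over a period -/

/-- The representative of `x` modulo `2π` in `[-π, π)`. -/
noncomputable def signedAngle (x : ℝ) : ℝ := toIcoMod Real.two_pi_pos (-π) x

@[fun_prop]
theorem measurable_signedAngle : Measurable signedAngle := by
  unfold signedAngle
  simp only [toIcoMod_eq_add_fract_mul]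
  fun_prop

theorem signedAngle_mem_Ico (x : ℝ) : signedAngle x ∈ Ico (-π) π := by
  have h := toIcoMod_mem_Ico Real.two_pi_pos (-π) x
  rwa [show -π + 2 * π = π by ring] at h

theorem abs_signedAngle_le (x : ℝ) : |signedAngle x| ≤ π :=
  abs_le.2 ⟨(signedAngle_mem_Ico x).1, (signedAngle_mem_Ico x).2.le⟩

theorem signedAngle_periodic : Function.Periodic signedAngle (2 * π) :=
  toIcoMod_periodic Real.two_pi_pos (-π)

theorem exists_eq_signedAngle_add (x : ℝ) : ∃ m : ℤ, x = signedAngle x + m * (2 * π) := by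
  refine ⟨toIcoDiv Real.two_pi_pos (-π) x, ?_⟩
  rw [← zsmul_eq_mul]
  exact (toIcoMod_add_toIcoDiv_zsmul Real.two_pi_pos (-π) x).symm

theorem signedAngle_eq_self {x : ℝ} (h : x ∈ Ico (-π) π) : signedAngle x = x := by
  refine (toIcoMod_eq_self Real.two_pi_pos).2 ?_
  rwa [show -π + 2 * π = π by ring]

theorem integral_comp_signedAngle (G : ℝ → ℝ) (t : ℝ) :
    ∫ x in t..(t + 2 * π), G (signedAngle x) = ∫ x in (-π)..π, G x := by
  have h := (signedAngle_periodic.comp G).intervalIntegral_add_eq t (-π)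
  rw [show -π + 2 * π = π by ring] at h
  simp only [Function.comp_apply] at h
  rw [h]
  refine intervalIntegral.integral_congr_ae ?_
  -- The endpoint π is excluded because its representative is -π.
  filter_upwards [Measure.ae_ne volume π] with x hx hmem
  rw [uIoc_of_le (by linarith [Real.pi_pos])] at hmem
  rw [signedAngle_eq_self ⟨hmem.1.le, lt_of_le_of_ne hmem.2 hx⟩]

theorem integral_comp_signedAngle_sub_right (G : ℝ → ℝ) (y : ℝ) :
    ∫ x in (0 : ℝ)..(2 * π), G (signedAngle (x - y)) = ∫ x in (-π)..π, G x := by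
  rw [intervalIntegral.integral_comp_sub_right (fun x => G (signedAngle x)) y,
    ← integral_comp_signedAngle G (0 - y)]
  congr 1
  ring

theorem integral_comp_signedAngle_sub_left (G : ℝ → ℝ) (y : ℝ) :
    ∫ x in (0 : ℝ)..(2 * π), G (signedAngle (y - x)) = ∫ x in (-π)..π, G x := by
  rw [intervalIntegral.integral_comp_sub_left (fun x => G (signedAngle x)) y,
    ← integral_comp_signedAngle G (y - 2 * π)]
  congr 1
  ring

theorem HasGaps.of_signedAngle {N : ℕ} [NeZero N] {θ : Fin N → ℝ}
    (h : ∀ j, signedAngle (θ (j + 1) - θ j) ≠ -π) :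
    HasGaps θ (fun j => signedAngle (θ (j + 1) - θ j)) := fun j =>
  ⟨abs_lt.2 ⟨lt_of_le_of_ne (signedAngle_mem_Ico _).1 (h j).symm, (signedAngle_mem_Ico _).2⟩,
    exists_eq_signedAngle_add _⟩

theorem HasGaps.exists_sum_eq {N : ℕ} [NeZero N] {θ δ : Fin N → ℝ} (h : HasGaps θ δ) :
    ∃ m : ℤ, ∑ j, δ j = m * (2 * π) := by
  choose m hm using fun j => (h j).2
  refine ⟨-∑ j, m j, ?_⟩
  have h1 : ∑ j, (θ (j + 1) - θ j) = ∑ j, (δ j + m j * (2 * π)) :=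
    Finset.sum_congr rfl fun j _ => hm j
  rw [Finset.sum_sub_distrib, Fin.sum_add_one, sub_self, Finset.sum_add_distrib,
    ← Finset.sum_mul] at h1
  push_cast
  linarith

/-- The winding number of four bugs is `-1`, `0` or `1`. -/
theorem HasGaps.sum_sq_eq {θ δ : Fin 4 → ℝ} (h : HasGaps θ δ) (hs : ∑ j, δ j ≠ 0) :
    (∑ j, δ j) ^ 2 = 4 * π ^ 2 := by
  obtain ⟨m, hm⟩ := h.exists_sum_eq
  have hπ := Real.pi_pos
  have hlt : |∑ j, δ j| < 4 * π := by
    refine (Finset.abs_sum_le_sum_abs _ _).trans_lt ?_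
    have := Finset.sum_lt_sum_of_nonempty (s := (Finset.univ : Finset (Fin 4)))
      Finset.univ_nonempty fun j _ => (h j).1
    simpa using this
  rw [hm, abs_mul, abs_of_pos Real.two_pi_pos] at hlt
  have h2 : |(m : ℝ)| < 2 := by nlinarith
  have h3 : |m| < 2 := by exact_mod_cast h2
  have h4 : m ≠ 0 := by
    rintro rfl
    simp [hm] at hs
  have h5 : m = 1 ∨ m = -1 := by
    have := abs_lt.1 h3
    omega
  rw [hm]
  rcases h5 with rfl | rfl <;> · push_cast; ring

/-! ### Moments of the random gaps -/

section Probability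

variable {Ω : Type*} [MeasurableSpace Ω] {P : Measure Ω} [IsProbabilityMeasure P]

/-- Fubini with the uniform variable integrated first; the inner integral does not depend on the
other variable. -/
theorem integral_of_isUniform_of_indepFun {β : Type*} [MeasurableSpace β] {X : Ω → ℝ} {Y : Ω → β}
    (hX : Measurable X) (hY : Measurable Y)
    (hu : pdf.IsUniform X (Ico 0 (2 * π)) P volume) (hXY : IndepFun X Y P)
    {F : ℝ × β → ℝ} (hF : Measurable F) {C : ℝ} (hC : ∀ p, |F p| ≤ C) {c : ℝ}
    (h : ∀ y, ∫ x in (0 : ℝ)..(2 * π), F (x, y) = c) :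
    ∫ ω, F (X ω, Y ω) ∂P = c / (2 * π) := by
  have hXP := Measure.isProbabilityMeasure_map (μ := P) hX.aemeasurable
  have hYP := Measure.isProbabilityMeasure_map (μ := P) hY.aemeasurable
  have hmap := (indepFun_iff_map_prod_eq_prod_map_map hX.aemeasurable hY.aemeasurable).1 hXY
  have h1 : ∫ ω, F (X ω, Y ω) ∂P = ∫ p, F p ∂((P.map X).prod (P.map Y)) := by
    rw [← hmap, integral_map (hX.prodMk hY).aemeasurable hF.aestronglyMeasurable]
  have hint : Integrable F ((P.map X).prod (P.map Y)) :=
    Integrable.of_bound hF.aestronglyMeasurable C (Filter.Eventually.of_forall hC)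
  have hin : ∀ y, ∫ x, F (x, y) ∂(P.map X) = c / (2 * π) := by
    intro y
    rw [hu, ProbabilityTheory.cond, integral_smul_measure, integral_Ico_eq_integral_Ioc,
      ← intervalIntegral.integral_of_le Real.two_pi_pos.le, h y, Real.volume_Ico, sub_zero,
      ENNReal.toReal_inv, ENNReal.toReal_ofReal Real.two_pi_pos.le, smul_eq_mul]
    field_simp
  rw [h1, integral_prod_symm _ hint]
  simp [hin]

variable {Θ : Fin 4 → Ω → ℝ}

theorem integral_comp_signedAngle_gap (hmeas : ∀ j, Measurable (Θ j))
    (hunif : ∀ j, pdf.IsUniform (Θ j) (Ico 0 (2 * π)) P volume) (hindep : iIndepFun Θ P)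
    {G : ℝ → ℝ} (hG : Measurable G) {C : ℝ} (hC : ∀ x, |G (signedAngle x)| ≤ C) (j : Fin 4) :
    ∫ ω, G (signedAngle (Θ (j + 1) ω - Θ j ω)) ∂P = (∫ x in (-π)..π, G x) / (2 * π) :=
  integral_of_isUniform_of_indepFun (F := fun p : ℝ × ℝ => G (signedAngle (p.1 - p.2)))
    (hmeas (j + 1)) (hmeas j) (hunif (j + 1)) (hindep.indepFun (by decide +revert)) (by fun_prop)
    (fun p => hC _) (fun y => integral_comp_signedAngle_sub_right G y)

theorem integral_gap_mul_self (hmeas : ∀ j, Measurable (Θ j))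
    (hunif : ∀ j, pdf.IsUniform (Θ j) (Ico 0 (2 * π)) P volume) (hindep : iIndepFun Θ P)
    (j : Fin 4) :
    ∫ ω, signedAngle (Θ (j + 1) ω - Θ j ω) * signedAngle (Θ (j + 1) ω - Θ j ω) ∂P
      = π ^ 2 / 3 := by
  rw [integral_comp_signedAngle_gap (G := fun x => x * x) hmeas hunif hindep (by fun_prop)
    (C := π * π) (fun x => by
      rw [abs_mul]
      exact mul_self_le_mul_self (abs_nonneg _) (abs_signedAngle_le x)) j]
  simp only [← pow_two, integral_pow]
  field_simp
  norm_num
  ring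

theorem ae_signedAngle_ne (hmeas : ∀ j, Measurable (Θ j))
    (hunif : ∀ j, pdf.IsUniform (Θ j) (Ico 0 (2 * π)) P volume) (hindep : iIndepFun Θ P) :
    ∀ᵐ ω ∂P, ∀ j, signedAngle (Θ (j + 1) ω - Θ j ω) ≠ -π := by
  rw [ae_all_iff]
  intro j
  have hms : MeasurableSet {ω | signedAngle (Θ (j + 1) ω - Θ j ω) = -π} :=
    measurableSet_eq_fun (measurable_signedAngle.comp ((hmeas _).sub (hmeas _))) measurable_const
  -- The probability of an antipodal pair is the expectation of the indicator of -π, which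
  -- integrates to zero.
  have h := integral_comp_signedAngle_gap (G := indicator {-π} 1) hmeas hunif hindep
    (measurable_one.indicator (measurableSet_singleton _)) (C := 1)
    (fun x => by simp only [indicator]; split_ifs <;> simp) j
  have h0 : ∫ x in (-π)..π, indicator {-π} (1 : ℝ → ℝ) x = 0 := by
    refine intervalIntegral.integral_zero_ae ?_
    filter_upwards [Measure.ae_ne volume (-π)] with x hx _
    simp [hx]
  have h1 : (fun ω => indicator {-π} (1 : ℝ → ℝ) (signedAngle (Θ (j + 1) ω - Θ j ω)))
      = indicator {ω | signedAngle (Θ (j + 1) ω - Θ j ω) = -π} 1 := by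
    ext ω
    simp [indicator]
  rw [h0, zero_div, h1, integral_indicator_one hms, measureReal_eq_zero_iff] at h
  exact measure_eq_zero_iff_ae_notMem.1 h

/-- Gap `j` does not involve angle `i`. With all other angles fixed, gap `i` is uniform and has mean
zero, so integrating out angle `i` kills the product. -/
theorem integral_gap_mul_gap_of_notMem (hmeas : ∀ j, Measurable (Θ j))
    (hunif : ∀ j, pdf.IsUniform (Θ j) (Ico 0 (2 * π)) P volume) (hindep : iIndepFun Θ P)
    {i j : Fin 4} (hj : j ≠ i) (hj' : j + 1 ≠ i) :
    ∫ ω, signedAngle (Θ (i + 1) ω - Θ i ω) * signedAngle (Θ (j + 1) ω - Θ j ω) ∂P = 0 := by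
  have hi : i + 1 ≠ i := by decide +revert
  have hφ : Measurable fun p : ({i} : Finset (Fin 4)) → ℝ => p ⟨i, Finset.mem_singleton_self i⟩ :=
    measurable_pi_apply _
  have hind := (hindep.indepFun_finset {i} {i}ᶜ disjoint_compl_right hmeas).comp hφ measurable_id
  have hmem : ∀ {k}, k ≠ i → k ∈ ({i}ᶜ : Finset (Fin 4)) := fun hk => by simpa using hk
  have := integral_of_isUniform_of_indepFun (hmeas i)
    (measurable_pi_lambda _ fun k => hmeas _) (hunif i) hind
    (F := fun p : ℝ × (({i}ᶜ : Finset (Fin 4)) → ℝ) => signedAngle (p.2 ⟨i + 1, hmem hi⟩ - p.1)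
      * signedAngle (p.2 ⟨j + 1, hmem hj'⟩ - p.2 ⟨j, hmem hj⟩))
    (by fun_prop) (C := π * π)
    (fun p => by
      rw [abs_mul]
      exact mul_le_mul (abs_signedAngle_le _) (abs_signedAngle_le _) (abs_nonneg _)
        Real.pi_pos.le)
    (c := 0)
    (fun y => by
      dsimp only
      rw [intervalIntegral.integral_mul_const,
        integral_comp_signedAngle_sub_left (fun x => x), integral_id]
      ring)
  simpa using this

theorem integral_gap_mul_gap (hmeas : ∀ j, Measurable (Θ j))
    (hunif : ∀ j, pdf.IsUniform (Θ j) (Ico 0 (2 * π)) P volume) (hindep : iIndepFun Θ P)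
    {i j : Fin 4} (hij : i ≠ j) :
    ∫ ω, signedAngle (Θ (i + 1) ω - Θ i ω) * signedAngle (Θ (j + 1) ω - Θ j ω) ∂P = 0 := by
  -- If gap `j` ends at bug `i`, the roles are swapped: among four bugs gap `i` cannot then end at
  -- bug `j`.
  by_cases h : j + 1 = i
  · have h' : i + 1 ≠ j := by decide +revert
    rw [← integral_gap_mul_gap_of_notMem hmeas hunif hindep hij h']
    simp only [mul_comm]
  · exact integral_gap_mul_gap_of_notMem hmeas hunif hindep hij.symm h

theorem integral_sum_gaps_sq (hmeas : ∀ j, Measurable (Θ j))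
    (hunif : ∀ j, pdf.IsUniform (Θ j) (Ico 0 (2 * π)) P volume) (hindep : iIndepFun Θ P) :
    ∫ ω, (∑ j, signedAngle (Θ (j + 1) ω - Θ j ω)) ^ 2 ∂P = 4 * π ^ 2 / 3 := by
  have hint : ∀ i j, Integrable (fun ω => signedAngle (Θ (i + 1) ω - Θ i ω)
      * signedAngle (Θ (j + 1) ω - Θ j ω)) P := fun i j => by
    refine Integrable.of_bound (C := π * π) (Measurable.aestronglyMeasurable ?_)
      (Filter.Eventually.of_forall fun ω => ?_)
    · exact (measurable_signedAngle.comp ((hmeas _).sub (hmeas _))).mul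
        (measurable_signedAngle.comp ((hmeas _).sub (hmeas _)))
    · rw [norm_mul]
      exact mul_le_mul (abs_signedAngle_le _) (abs_signedAngle_le _) (abs_nonneg _)
        Real.pi_pos.le
  simp only [pow_two (∑ j, _), Finset.sum_mul_sum]
  rw [integral_finsetSum _ fun i _ => integrable_finsetSum _ fun j _ => hint i j]
  have : ∀ i, ∫ ω, ∑ j, signedAngle (Θ (i + 1) ω - Θ i ω)
      * signedAngle (Θ (j + 1) ω - Θ j ω) ∂P = π ^ 2 / 3 := by
    intro i
    rw [integral_finsetSum _ fun j _ => hint i j, Finset.sum_eq_single i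
      (fun j _ hj => integral_gap_mul_gap hmeas hunif hindep hj.symm) (by simp),
      integral_gap_mul_self hmeas hunif hindep]
  simp only [this]
  simp
  ring

theorem measureReal_sum_gaps_ne_zero (hmeas : ∀ j, Measurable (Θ j))
    (hunif : ∀ j, pdf.IsUniform (Θ j) (Ico 0 (2 * π)) P volume) (hindep : iIndepFun Θ P) :
    P.real {ω | ∑ j, signedAngle (Θ (j + 1) ω - Θ j ω) ≠ 0} = 1 / 3 := by
  have hms : MeasurableSet {ω | ∑ j, signedAngle (Θ (j + 1) ω - Θ j ω) ≠ 0} :=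
    (measurableSet_eq_fun (Finset.measurable_sum _ fun j _ =>
      measurable_signedAngle.comp ((hmeas _).sub (hmeas _))) measurable_const).compl
  have h1 : ∫ ω, (∑ j, signedAngle (Θ (j + 1) ω - Θ j ω)) ^ 2 ∂P
      = ∫ ω, indicator {ω | ∑ j, signedAngle (Θ (j + 1) ω - Θ j ω) ≠ 0}
        (fun _ => 4 * π ^ 2) ω ∂P := by
    refine integral_congr_ae ?_
    filter_upwards [ae_signedAngle_ne hmeas hunif hindep] with ω hω
    by_cases h0 : ∑ j, signedAngle (Θ (j + 1) ω - Θ j ω) = 0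
    · rw [indicator_of_notMem (by simpa using h0), h0]
      simp
    · simp only [indicator, mem_ofPred_eq, ne_eq, h0, not_false_eq_true, if_true]
      exact (HasGaps.of_signedAngle (θ := fun j => Θ j ω) hω).sum_sq_eq h0
  rw [integral_sum_gaps_sq hmeas hunif hindep, integral_indicator_const _ hms, smul_eq_mul] at h1
  have hπ : (0 : ℝ) < 4 * π ^ 2 := by positivity
  nlinarith

end Probability

/-! ### Final states and their probabilities -/

theorem mainTheorem1 {Ω : Type*} [MeasurableSpace Ω] (P : Measure Ω) [IsProbabilityMeasure P]
    (Θ : Fin 4 → Ω → ℝ) (hmeas : ∀ j, Measurable (Θ j))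
    (hunif : ∀ j, pdf.IsUniform (Θ j) (Ico 0 (2 * π)) P volume)
    (hindep : iIndepFun Θ P) :
    (∀ᵐ ω ∂P, ∃ θ : ℝ → Fin 4 → ℝ, IsPursuit (fun j => Θ j ω) θ ∧
      ∀ θ' : ℝ → Fin 4 → ℝ, IsPursuit (fun j => Θ j ω) θ' → EqOn θ' θ (Ici 0)) ∧
    NullMeasurableSet {ω | Cycles (fun j => Θ j ω)} P ∧
    P {ω | Cycles (fun j => Θ j ω)} = 1 / 3 ∧
    (∀ᵐ ω ∂P, Coalesces (fun j => Θ j ω) ↔ ¬ Cycles (fun j => Θ j ω)) ∧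
    P {ω | Coalesces (fun j => Θ j ω)} = 2 / 3 := by
  have hgaps : ∀ᵐ ω ∂P, HasGaps (fun j => Θ j ω)
      (fun j => signedAngle (Θ (j + 1) ω - Θ j ω)) := by
    filter_upwards [ae_signedAngle_ne hmeas hunif hindep] with ω hω
    exact HasGaps.of_signedAngle (θ := fun j => Θ j ω) hω
  have hreal := measureReal_sum_gaps_ne_zero hmeas hunif hindep
  set S := {ω | ∑ j, signedAngle (Θ (j + 1) ω - Θ j ω) ≠ 0} with hS
  have hms : MeasurableSet S :=
    (measurableSet_eq_fun (Finset.measurable_sum _ fun j _ =>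
      measurable_signedAngle.comp ((hmeas _).sub (hmeas _))) measurable_const).compl
  have hcyc : {ω | Cycles (fun j => Θ j ω)} =ᵐ[P] S := by
    rw [Filter.eventuallyEq_set]
    filter_upwards [hgaps] with ω hω
    exact hω.cycles_iff
  have hcoal : P {ω | Coalesces (fun j => Θ j ω)} = P Sᶜ := by
    refine measure_congr (Filter.eventuallyEq_set.2 ?_)
    filter_upwards [hgaps] with ω hω
    rw [mem_compl_iff, hS, mem_ofPred_eq, not_not]
    exact hω.coalesces_iff
  have hcompl := probReal_compl_eq_one_sub (μ := P) hms
  refine ⟨?_, hms.nullMeasurableSet.congr hcyc.symm, ?_, ?_, ?_⟩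
  · filter_upwards [hgaps] with ω hω
    exact hω.exists_unique_isPursuit
  · rw [measure_congr hcyc, ← ENNReal.toReal_eq_toReal_iff' (measure_ne_top _ _)
      (ENNReal.div_ne_top (by simp) (by simp))]
    simpa [measureReal_def] using hreal
  · filter_upwards [hgaps] with ω hω
    rw [hω.cycles_iff, hω.coalesces_iff, not_not]
  · rw [hcoal, ← ENNReal.toReal_eq_toReal_iff' (measure_ne_top _ _)
      (ENNReal.div_ne_top (by simp) (by simp)), ← measureReal_def, hcompl, hreal]
    norm_num
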